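/- A poset $P$ is *upho* if for every $s\in P$ the principal order filter $V_s=\{p\in P\mid s\le p\}$ is isomorphic to $P$. A *coloring* of an upho poset $P$ with least element $\hat 0$ is a map $\mathrm{col}$ from the covering pairs $u\lessdot v$ of $P$ to the atoms of $P$ such that $\mathrm{col}(\hat 0,t)=t$ for every atom $t$, and for every $s\in P$ there is an isomorphism $\phi_s:V_s\to P$ with $\mathrm{col}(u,v)=\mathrm{col}(\phi_s(u),\phi_s(v))$ for every covering pair $u\lessdot v$ in $V_s$; $P$ is *regular* if it admits a coloring. A power series $f(x)\in 1+x\mathbb{Z}[[x]]$ is an *upho function* (resp. a *regular upho function*) if it is the rank-generating function $\sum_{k\ge 0}|P_k|x^k$ of an $\mathbb{N}$-graded upho poset (resp. regular upho poset) $P$ all of whose layers $P_k$ are finite. **Proposition.** Let $f(x)\in 1+x\mathbb{Z}_{\ge 0}[[x]]$ be a formal power series of the form $$f(x)=\frac{1}{h(x)}=\prod_{i=1}^{n}\frac{1}{1-\lambda_i x},\qquad 0<\lambda_1<\cdots<\lambda_n,$$ where $h(x)\in\mathbb{Z}[x]$ is irreducible over $\mathbb{Z}[x]$ of degree $n\ge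 2$, the $\lambda_i$ are real, and $1<\lambda_{n-1}<\lambda_n$. Then $f(x)$ is a regular upho function; in particular, it is an upho function. -/

import Mathlib

namespace Upho

/-- A poset `P` is upper homogeneous (upho) if every principal order filter
`V_s = {p | s ≤ p}` is isomorphic to `P`. -/
def IsUpho (P : Type*) [PartialOrder P] : Prop :=
  ∀ s : P, Nonempty (Set.Ici s ≃o P)

/-- The `k`-th layer of an `ℕ`-graded poset. `GradeMinOrder ℕ P` says that `P` is `ℕ`-graded:
the rank function is strictly monotone, increases by exactly one along each covering relation,
and vanishes at the minimal elements. Equivalently, every maximal chain is of the form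
`p₀ ⋖ p₁ ⋖ p₂ ⋖ ⋯` with `pᵢ` of rank `i`. -/
def layer (P : Type*) [PartialOrder P] [GradeMinOrder ℕ P] (k : ℕ) : Set P :=
  {p | grade ℕ p = k}

/-- An `ℕ`-graded poset is of finite type if all of its layers are finite. -/
def IsFiniteType (P : Type*) [PartialOrder P] [GradeMinOrder ℕ P] : Prop :=
  ∀ k : ℕ, (layer P k).Finite

/-- The rank-generating function `∑ₖ |Pₖ| xᵏ` (meaningful for posets of finite type). -/
noncomputable def rankGenFun (P : Type*) [PartialOrder P] [GradeMinOrder ℕ P] : PowerSeries ℤ :=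
  PowerSeries.mk fun k => ((layer P k).ncard : ℤ)

/-- The edges of the Hasse diagram of `P`. -/
abbrev Edge (P : Type*) [PartialOrder P] : Type _ := {e : P × P // e.1 ⋖ e.2}

/-- The atoms of a poset with least element. -/
abbrev Atom (P : Type*) [PartialOrder P] [OrderBot P] : Type _ := {t : P // ⊥ ⋖ t}

/-- An edge of a principal order filter, viewed as an edge of the whole poset. -/
def Edge.ofIci {P : Type*} [PartialOrder P] {s : P} (e : Edge (Set.Ici s)) : Edge P :=
  ⟨(e.1.1.1, e.1.2.1), e.2.1, fun _ hac hcb =>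
    e.2.2 (c := ⟨_, le_trans e.1.1.2 hac.le⟩) hac hcb⟩

/-- The image of an edge under an isomorphism of posets. -/
def Edge.map {P Q : Type*} [PartialOrder P] [PartialOrder Q] (φ : P ≃o Q) (e : Edge P) :
    Edge Q :=
  ⟨(φ e.1.1, φ e.1.2), (apply_covBy_apply_iff φ).2 e.2⟩

/-- The compatibility conditions that make `(P, col)` a colored upho poset: the edge from the
least element to an atom `t` has color `t`, and each principal order filter is isomorphic to `P`
by an isomorphism that preserves the colors of edges. -/
structure IsColoring {P : Type*} [PartialOrder P] [OrderBot P] (col : Edge P → Atom P) :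
    Prop where
  col_atom : ∀ t : Atom P, col ⟨(⊥, t.1), t.2⟩ = t
  exists_iso : ∀ s : P, ∃ φ : Set.Ici s ≃o P,
    ∀ e : Edge (Set.Ici s), col e.ofIci = col (e.map φ)

/-- A regular upho poset: an upho poset that admits a compatible coloring.
(A nonempty upho poset always has a least element.) -/
def IsRegularUpho (P : Type*) [PartialOrder P] [OrderBot P] : Prop :=
  IsUpho P ∧ ∃ col : Edge P → Atom P, IsColoring col

/-- `f ∈ 1 + xℤ[[x]]` is an upho function if it is the rank-generating function of a finite type
`ℕ`-graded upho poset. (Such posets are countable, so posets in `Type` suffice.) -/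
def IsUphoFunction (f : PowerSeries ℤ) : Prop :=
  PowerSeries.constantCoeff f = 1 ∧
    ∃ (P : Type) (_ : PartialOrder P) (_ : GradeMinOrder ℕ P),
      IsFiniteType P ∧ IsUpho P ∧ rankGenFun P = f

/-- `f ∈ 1 + xℤ[[x]]` is a regular upho function if it is the rank-generating function of a
finite type `ℕ`-graded regular upho poset. -/
def IsRegularUphoFunction (f : PowerSeries ℤ) : Prop :=
  PowerSeries.constantCoeff f = 1 ∧
    ∃ (P : Type) (_ : PartialOrder P) (_ : OrderBot P) (_ : GradeMinOrder ℕ P),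
      IsFiniteType P ∧ IsRegularUpho P ∧ rankGenFun P = f

/-- A regular upho function is an upho function. -/
theorem IsRegularUphoFunction.isUphoFunction {f : PowerSeries ℤ}
    (hf : IsRegularUphoFunction f) : IsUphoFunction f := by
  obtain ⟨h0, P, i1, _, i3, hft, hreg, hF⟩ := hf
  exact ⟨h0, P, i1, i3, hft, hreg.1, hF⟩

end Upho

/-! Let `l k` be the coefficients of `(1 - x) f`. With `a`, `b` the two largest `λ`'s, the
coefficients of `(1 - x)/((1 - a x)(1 - b x))` are positive and log-concave
(`isLogConcave_of_mul_mul_eq`). Dividing by the remaining factors `1 - c x`, `c > 0`, preserves this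
(`IsLogConcave.of_mul_one_sub`), so `l` is positive and log-concave with `l 0 = 1`.

Such an `l` counts the words of a factor-closed language `L`, built greedily by prepending letters
in lexicographic order. Suffix-closure is built in; prefix-closure is where log-concavity is needed
(`append_singleton_mem_lexLanguage`).

Identify words of equal length having the same prefixes in `L`. The quotient is a right cancellative
monoid whose elements of length `k` correspond to the words of `L` of length at most `k`, so they
number `l 0 + ... + l k`, the coefficient of `x ^ k` in `f`. Ordering this monoid by right factors
gives the poset: the filter above `s` is the set of left multiples of `s`, a copy of the monoid. -/

/-! ### Regular upho posets from graded right cancellative monoids -/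

/-- The order on a graded monoid in which `a ≤ b` when `a` is a right factor of `b`. -/
abbrev rightFactorOrder {M : Type} [Monoid M] (len : M → ℕ)
    (hmul : ∀ a b, len (a * b) = len a + len b) (hone : ∀ a, len a = 0 → a = 1) :
    PartialOrder M where
  le a b := ∃ c, b = c * a
  le_refl a := ⟨1, (one_mul a).symm⟩
  le_trans := by
    rintro a b c ⟨d, rfl⟩ ⟨e, rfl⟩
    exact ⟨e * d, (mul_assoc _ _ _).symm⟩
  le_antisymm := by
    rintro a b ⟨c, hc⟩ ⟨d, hd⟩
    have h1 := congrArg len hc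
    have h2 := congrArg len hd
    rw [hmul] at h1 h2
    rw [hc, hone c (by omega), one_mul]

/-- The right-factor order of a graded right cancellative monoid generated in degree one
makes it a regular upho poset, whose rank-generating function is the growth series. -/
theorem isRegularUphoFunction_of_monoid {M : Type} [Monoid M] (len : M → ℕ)
    (hmul : ∀ a b, len (a * b) = len a + len b) (hone : ∀ a, len a = 0 → a = 1)
    (hcancel : ∀ a b c : M, a * c = b * c → a = b)
    (hgen : ∀ a, len a ≠ 0 → ∃ b t, len t = 1 ∧ a = b * t)
    (hfin : ∀ k, {a | len a = k}.Finite)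
    (f : PowerSeries ℤ) (hf : ∀ k, PowerSeries.coeff k f = ({a | len a = k}.ncard : ℤ)) :
    Upho.IsRegularUphoFunction f := by
  let _ : PartialOrder M := rightFactorOrder len hmul hone
  have le_iff : ∀ a b : M, a ≤ b ↔ ∃ c, b = c * a := fun _ _ => Iff.rfl
  have len_one : len 1 = 0 := by
    have := hmul 1 1
    rw [one_mul] at this
    omega
  have len_mono : StrictMono len := by
    intro a b hab
    obtain ⟨c, rfl⟩ := hab.le
    rw [hmul]
    have : len c ≠ 0 := fun h => hab.ne (by rw [hone c h, one_mul])
    omega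
  have covBy_iff : ∀ a b : M, a ⋖ b ↔ ∃ t, len t = 1 ∧ b = t * a := by
    intro a b
    constructor
    · intro hab
      obtain ⟨c, rfl⟩ := hab.1.le
      have hc : len c ≠ 0 := fun h => hab.1.ne (by rw [hone c h, one_mul])
      obtain ⟨d, t, ht, rfl⟩ := hgen c hc
      refine ⟨t, ht, ?_⟩
      have h1 : a < t * a := by
        refine lt_of_le_of_ne ⟨t, rfl⟩ fun h => ?_
        have := congrArg len h
        rw [hmul] at this
        omega
      have h2 : t * a ≤ d * t * a := ⟨d, mul_assoc _ _ _⟩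
      rcases h2.eq_or_lt with h | h
      · exact h.symm
      · exact absurd h (hab.2 h1)
    · rintro ⟨t, ht, rfl⟩
      have hl := hmul t a
      refine ⟨lt_of_le_of_ne ⟨t, rfl⟩ fun h => ?_, fun c hac hcb => ?_⟩
      · have := congrArg len h
        omega
      · have h1 := len_mono hac
        have h2 := len_mono hcb
        omega
  let _ : OrderBot M := { bot := 1, bot_le := fun a => ⟨a, (mul_one a).symm⟩ }
  let _ : GradeMinOrder ℕ M :=
    { grade := len
      grade_strictMono := len_mono
      covBy_grade := by
        intro a b hab
        obtain ⟨t, ht, rfl⟩ := (covBy_iff a b).1 hab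
        rw [hmul, ht, Nat.covBy_iff_add_one_eq]
        omega
      isMin_grade := by
        intro a ha
        have : a = 1 := (isMin_iff_eq_bot.1 ha)
        rw [this, len_one]
        exact isMin_bot }
  have hlayer : ∀ k, Upho.layer M k = {a | len a = k} := fun _ => rfl
  let ψ : ∀ s : M, M ≃o Set.Ici s := fun s =>
    { toEquiv := Equiv.ofBijective (fun c => (⟨c * s, c, rfl⟩ : Set.Ici s))
        ⟨fun a b hab => hcancel a b s (congrArg Subtype.val hab), by
          rintro ⟨_, c, rfl⟩
          exact ⟨c, rfl⟩⟩
      map_rel_iff' := by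
        intro a b
        change (∃ e, b * s = e * (a * s)) ↔ ∃ e, b = e * a
        refine exists_congr fun e => ⟨fun h => ?_, fun h => ?_⟩
        · exact hcancel _ _ s (by rw [h, mul_assoc])
        · rw [h, mul_assoc] }
  have hψ : ∀ s c, ((ψ s c : Set.Ici s) : M) = c * s := fun _ _ => rfl
  have hψs : ∀ s (x : Set.Ici s), (x : M) = (ψ s).symm x * s := by
    intro s x
    rw [← hψ, OrderIso.apply_symm_apply]
  have hedge : ∀ e : Upho.Edge M, ∃ t, len t = 1 ∧ e.1.2 = t * e.1.1 :=
    fun e => (covBy_iff _ _).1 e.2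
  -- The edge from `a` to `t * a` gets color `t`, unique by cancellation and unchanged by right
  -- multiplication by `s`.
  choose c hc1 hc2 using hedge
  have hc3 : ∀ e t, e.1.2 = t * e.1.1 → c e = t := fun e t h =>
    hcancel _ _ e.1.1 (by rw [← hc2, h])
  refine ⟨?_, M, inferInstance, inferInstance, inferInstance, hfin, ⟨fun s => ⟨(ψ s).symm⟩, ?_⟩, ?_⟩
  · have : {a | len a = 0} = {(1 : M)} := by
      ext a
      exact ⟨hone a, fun h => by rw [Set.mem_singleton_iff.1 h]; exact len_one⟩
    rw [← PowerSeries.coeff_zero_eq_constantCoeff_apply, hf, this]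
    simp
  · refine ⟨fun e => ⟨c e, (covBy_iff _ _).2 ⟨c e, hc1 e, (mul_one _).symm⟩⟩, ?_, ?_⟩
    · intro t
      exact Subtype.ext (hc3 _ _ (mul_one _).symm)
    · intro s
      refine ⟨(ψ s).symm, fun e => Subtype.ext (hc3 _ _ ?_)⟩
      change (e.1.2 : M) = _ * (e.1.1 : M)
      rw [hψs s e.1.2, hψs s e.1.1, ← mul_assoc]
      congr 1
      exact hc2 (e.map (ψ s).symm)
  · ext k
    rw [hf, Upho.rankGenFun, PowerSeries.coeff_mk, hlayer]

/-! ### The monoid of a factor-closed language -/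

/-- Words over `ℕ` are identified when they have the same length and the same prefixes in `L`. -/
def prefixCon (L : Set (List ℕ)) (hpre : ∀ u v, u ++ v ∈ L → u ∈ L)
    (hsuf : ∀ u v, u ++ v ∈ L → v ∈ L) : Con (FreeMonoid ℕ) where
  r u v := u.toList.length = v.toList.length ∧ ∀ p ∈ L, p <+: u.toList ↔ p <+: v.toList
  iseqv :=
    ⟨fun _ => ⟨rfl, fun _ _ => Iff.rfl⟩, fun h => ⟨h.1.symm, fun p hp => (h.2 p hp).symm⟩,
      fun h h' => ⟨h.1.trans h'.1, fun p hp => (h.2 p hp).trans (h'.2 p hp)⟩⟩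
  mul' := by
    -- A prefix of `u ++ v` in `L` either lies within `u`, or is `u ++ q`. In the latter case `u ∈
    -- L` forces `u = u'`, and `q ∈ L` is a prefix of `v`.
    have key : ∀ u u' v v' p : List ℕ, u.length = u'.length → v.length = v'.length →
        (∀ p ∈ L, p <+: u → p <+: u') → (∀ p ∈ L, p <+: v → p <+: v') →
        p ∈ L → p <+: u ++ v → p <+: u' ++ v' := by
      intro u u' v v' p hlu hlv hu hv hp h
      rcases le_total p.length u.length with hl | hl
      · exact (hu p hp (List.prefix_of_prefix_length_le h (List.prefix_append u v) hl)).trans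
          (List.prefix_append _ _)
      · obtain ⟨q, rfl⟩ := List.prefix_of_prefix_length_le (List.prefix_append u v) h hl
        have huu : u = u' := (hu u (hpre _ _ hp) (List.prefix_refl u)).eq_of_length hlu
        subst huu
        rw [List.prefix_append_right_inj] at h ⊢
        exact hv q (hsuf _ _ hp) h
    intro u u' v v' h h'
    refine ⟨by simp [h.1, h'.1], fun p hp => ⟨?_, ?_⟩⟩
    · exact key _ _ _ _ p h.1 h'.1 (fun q hq => (h.2 q hq).1) (fun q hq => (h'.2 q hq).1) hp
    · exact key _ _ _ _ p h.1.symm h'.1.symm (fun q hq => (h.2 q hq).2)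
        (fun q hq => (h'.2 q hq).2) hp

theorem prefixCon_iff {L : Set (List ℕ)} {hpre : ∀ u v, u ++ v ∈ L → u ∈ L}
    {hsuf : ∀ u v, u ++ v ∈ L → v ∈ L} {u v : FreeMonoid ℕ} :
    prefixCon L hpre hsuf u v ↔
      u.toList.length = v.toList.length ∧ ∀ p ∈ L, p <+: u.toList ↔ p <+: v.toList :=
  Iff.rfl

theorem prefix_append_replicate_iff {p q : List ℕ} {w : ℕ} (hw : w ∉ p) (j : ℕ) :
    p <+: q ++ List.replicate j w ↔ p <+: q := by
  refine ⟨fun h => ?_, fun h => h.trans (List.prefix_append _ _)⟩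
  rcases le_total p.length q.length with hl | hl
  · exact List.prefix_of_prefix_length_le h (List.prefix_append _ _) hl
  · obtain ⟨r, rfl⟩ := List.prefix_of_prefix_length_le (List.prefix_append q _) h hl
    rw [List.prefix_append_right_inj] at h
    cases r with
    | nil => simp
    | cons x r =>
      have hx : x = w := List.eq_of_mem_replicate (h.subset List.mem_cons_self)
      exact absurd (by simp [hx]) hw

/-- If `L` is a factor-closed language that omits some letter, then the partial sums of its
growth sequence are the coefficients of a regular upho function. -/
theorem isRegularUphoFunction_of_language (L : Set (List ℕ)) (hnil : [] ∈ L)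
    (hpre : ∀ u v, u ++ v ∈ L → u ∈ L) (hsuf : ∀ u v, u ++ v ∈ L → v ∈ L)
    (w : ℕ) (hw : ∀ u ∈ L, w ∉ u) (hfin : ∀ k, {u ∈ L | u.length = k}.Finite)
    (f : PowerSeries ℤ) (hf0 : PowerSeries.coeff 0 f = 1)
    (hf : ∀ k, PowerSeries.coeff (k + 1) f =
      PowerSeries.coeff k f + ({u ∈ L | u.length = k + 1}.ncard : ℤ)) :
    Upho.IsRegularUphoFunction f := by
  classical
  let r := prefixCon L hpre hsuf
  let len : r.Quotient → ℕ := fun a => Con.liftOn a (fun u => u.toList.length) fun _ _ h => h.1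
  have hlen : ∀ u : FreeMonoid ℕ, len (u : r.Quotient) = u.toList.length := fun _ => rfl
  -- normal forms
  let nf : ℕ → List ℕ → r.Quotient := fun k p =>
    ((FreeMonoid.ofList (p ++ List.replicate (k - p.length) w) : FreeMonoid ℕ) : r.Quotient)
  have hnf : ∀ k, {a | len a = k} = nf k '' {u ∈ L | u.length ≤ k} := by
    intro k
    ext a
    induction a using Con.induction_on with | _ u
    constructor
    · intro hu
      replace hu : u.toList.length = k := hu
      -- The class of `u` is determined by its length and its longest prefix in `L`; all shorter
      -- prefixes in `L` are prefixes of that one. Padding with `w` restores the length without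
      -- creating new prefixes in `L`.
      let j := Nat.findGreatest (fun i => u.toList.take i ∈ L) k
      have hj : u.toList.take j ∈ L :=
        Nat.findGreatest_spec (P := fun i => u.toList.take i ∈ L) (Nat.zero_le k) (by simpa using hnil)
      have hjk : j ≤ k := Nat.findGreatest_le k
      have hjl : (u.toList.take j).length = j := by simp; omega
      refine ⟨u.toList.take j, ⟨hj, by omega⟩, ?_⟩
      refine (Con.eq r).2 (prefixCon_iff.2 ⟨?_, fun p hp => ?_⟩)
      · rw [FreeMonoid.toList_ofList, List.length_append, List.length_replicate, hjl, hu]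
        omega
      · rw [FreeMonoid.toList_ofList, prefix_append_replicate_iff (hw p hp)]
        refine ⟨fun h => h.trans (List.take_prefix _ _), fun h => ?_⟩
        have hpe := List.prefix_iff_eq_take.1 h
        have : p.length ≤ j :=
          Nat.le_findGreatest (by rw [← hu]; exact h.length_le)
            (by rw [← hpe]; exact hp)
        exact List.prefix_of_prefix_length_le h (List.take_prefix _ _) (by omega)
    · rintro ⟨p, ⟨-, hp⟩, hpu⟩
      rw [← hpu]
      change (p ++ List.replicate (k - p.length) w).length = k
      simp
      omega
  have hinj : ∀ k, Set.InjOn (nf k) {u ∈ L | u.length ≤ k} := by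
    intro k p hp q hq hpq
    have h := (prefixCon_iff.1 ((Con.eq r).1 hpq)).2
    simp only [FreeMonoid.toList_ofList] at h
    have h1 := (h p hp.1).1 (List.prefix_append _ _)
    have h2 := (h q hq.1).2 (List.prefix_append _ _)
    rw [prefix_append_replicate_iff (hw _ hp.1)] at h1
    rw [prefix_append_replicate_iff (hw _ hq.1)] at h2
    exact h1.eq_of_length_le h2.length_le
  have hsplit : ∀ k, {u ∈ L | u.length ≤ k + 1} =
      {u ∈ L | u.length ≤ k} ∪ {u ∈ L | u.length = k + 1} := by
    intro k
    ext u
    simp only [Set.mem_ofPred_eq, Set.mem_union]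
    rw [← and_or_left, Nat.le_add_one_iff]
  have hzero : {u ∈ L | u.length ≤ 0} = {[]} := by
    ext u
    simp only [Set.mem_ofPred_eq, Nat.le_zero, List.length_eq_zero_iff, Set.mem_singleton_iff]
    exact ⟨fun h => h.2, fun h => ⟨h ▸ hnil, h⟩⟩
  have hfin' : ∀ k, {u ∈ L | u.length ≤ k}.Finite := by
    intro k
    induction k with
    | zero => rw [hzero]; exact Set.finite_singleton _
    | succ k ih => rw [hsplit]; exact ih.union (hfin _)
  refine isRegularUphoFunction_of_monoid len ?_ ?_ ?_ ?_ ?_ f ?_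
  · intro a b
    induction a using Con.induction_on with | _ u
    induction b using Con.induction_on with | _ v
    rw [← Con.coe_mul, hlen, hlen, hlen, FreeMonoid.toList_mul, List.length_append]
  · intro a ha
    induction a using Con.induction_on with | _ u
    rw [hlen, List.length_eq_zero_iff] at ha
    have : u = 1 := ha
    rw [this, Con.coe_one]
  · intro a b c habc
    induction a using Con.induction_on with | _ u
    induction b using Con.induction_on with | _ v
    induction c using Con.induction_on with | _ x
    rw [← Con.coe_mul, ← Con.coe_mul, Con.eq] at habc
    obtain ⟨h1, h2⟩ := prefixCon_iff.1 habc
    simp only [FreeMonoid.toList_mul, List.length_append, add_left_inj] at h1 h2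
    -- Cancellation: the prefixes of `u` are the prefixes of `u ++ x` of length at most that of `u`,
    -- and `u`, `v` have equal length.
    refine (Con.eq r).2 (prefixCon_iff.2 ⟨h1, fun p hp => ⟨fun h => ?_, fun h => ?_⟩⟩)
    · exact List.prefix_of_prefix_length_le ((h2 p hp).1 (h.trans (List.prefix_append _ _)))
        (List.prefix_append _ _) (h1 ▸ h.length_le)
    · exact List.prefix_of_prefix_length_le ((h2 p hp).2 (h.trans (List.prefix_append _ _)))
        (List.prefix_append _ _) (h1 ▸ h.length_le)
  · intro a ha
    induction a using Con.induction_on with | _ u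
    rw [hlen] at ha
    rcases List.eq_nil_or_concat u.toList with h | ⟨v, x, h⟩
    · simp [h] at ha
    · refine ⟨((FreeMonoid.ofList v : FreeMonoid ℕ) : r.Quotient),
        ((FreeMonoid.of x : FreeMonoid ℕ) : r.Quotient), rfl, ?_⟩
      rw [← Con.coe_mul]
      congr 1
      exact h.trans List.concat_eq_append
  · intro k
    rw [hnf]
    exact (hfin' k).image _
  · intro k
    rw [hnf, (hinj k).ncard_image]
    induction k with
    | zero => rw [hzero, hf0]; simp
    | succ k ih =>
      rw [hf, ih, hsplit, Set.ncard_union_eq _ (hfin' k) (hfin _)]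
      · push_cast
        rfl
      · rw [Set.disjoint_left]
        rintro u ⟨-, h⟩ ⟨-, h'⟩
        omega

/-! ### A factor-closed language with log-concave growth -/

/-- The lexicographic index of a word, among the words of its length. -/
def lexIndex (l : ℕ → ℕ) : List ℕ → ℕ
  | [] => 0
  | z :: v => z * l v.length + lexIndex l v

/-- The language whose words of length `k + 1` are the `l (k + 1)` lexicographically first words
`z :: v` with `v` in the language of length `k`. -/
def lexLanguage (l : ℕ → ℕ) : Set (List ℕ) :=
  {u | ∀ v, v <:+ u → lexIndex l v < l v.length}

section LexLanguage

variable {l : ℕ → ℕ}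

theorem cons_mem_lexLanguage {z : ℕ} {v : List ℕ} :
    z :: v ∈ lexLanguage l ↔
      z * l v.length + lexIndex l v < l (v.length + 1) ∧ v ∈ lexLanguage l := by
  simp [lexLanguage, List.suffix_cons_iff, lexIndex]

theorem nil_mem_lexLanguage (hpos : ∀ k, 0 < l k) : [] ∈ lexLanguage l := by
  simp [lexLanguage, lexIndex, hpos]

theorem lexIndex_lt {u : List ℕ} (hu : u ∈ lexLanguage l) : lexIndex l u < l u.length :=
  hu u (List.suffix_refl u)

/-- The relative position `lexIndex l u / l u.length` cannot increase when the last letter is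
deleted, so it stays below `1`. Prepending `z` preserves the comparison because the ratios `l (k +
1) / l k` are nonincreasing. -/
theorem append_singleton_mem_lexLanguage (hpos : ∀ k, 0 < l k)
    (hlc : ∀ k, l k * l (k + 2) ≤ l (k + 1) ^ 2) (v : List ℕ) (y : ℕ)
    (h : v ++ [y] ∈ lexLanguage l) :
    v ∈ lexLanguage l ∧
      lexIndex l v * l (v.length + 1) ≤ lexIndex l (v ++ [y]) * l v.length := by
  induction v with
  | nil => exact ⟨nil_mem_lexLanguage hpos, by simp [lexIndex]⟩
  | cons z v ih =>
    have hlt := lexIndex_lt h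
    obtain ⟨-, h'⟩ := cons_mem_lexLanguage.1 h
    obtain ⟨hv, hle⟩ := ih h'
    simp only [List.cons_append, lexIndex, List.length_append, List.length_cons, List.length_nil,
      zero_add] at hlt ⊢
    set k := v.length
    set a := lexIndex l v
    set b := lexIndex l (v ++ [y])
    have h1 : (z * l k + a) * l (k + 1) ≤ (z * l (k + 1) + b) * l k := by nlinarith
    have h2 : (z * l k + a) * l (k + 2) ≤ (z * l (k + 1) + b) * l (k + 1) := by
      refine Nat.le_of_mul_le_mul_left ?_ (hpos k)
      calc l k * ((z * l k + a) * l (k + 2)) = (z * l k + a) * (l k * l (k + 2)) := by ring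
        _ ≤ (z * l k + a) * l (k + 1) ^ 2 := Nat.mul_le_mul_left _ (hlc k)
        _ = (z * l k + a) * l (k + 1) * l (k + 1) := by ring
        _ ≤ (z * l (k + 1) + b) * l k * l (k + 1) := Nat.mul_le_mul_right _ h1
        _ = l k * ((z * l (k + 1) + b) * l (k + 1)) := by ring
    refine ⟨cons_mem_lexLanguage.2 ⟨?_, hv⟩, h2⟩
    refine Nat.lt_of_mul_lt_mul_right (a := l (k + 2)) (h2.trans_lt ?_)
    rw [mul_comm (l (k + 1))]
    exact Nat.mul_lt_mul_of_pos_right hlt (hpos _)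

theorem lexLanguage_prefix_closed (hpos : ∀ k, 0 < l k)
    (hlc : ∀ k, l k * l (k + 2) ≤ l (k + 1) ^ 2) (u v : List ℕ)
    (h : u ++ v ∈ lexLanguage l) : u ∈ lexLanguage l := by
  induction v using List.reverseRecOn with
  | nil => simpa using h
  | append_singleton v y ih =>
    rw [← List.append_assoc] at h
    exact ih (append_singleton_mem_lexLanguage hpos hlc _ y h).1

theorem lexLanguage_suffix_closed (u v : List ℕ) (h : u ++ v ∈ lexLanguage l) :
    v ∈ lexLanguage l :=
  fun x hx => h x (hx.trans (List.suffix_append u v))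

/-- Division with remainder by `l k` decodes an index: the quotient is the first letter and the
remainder is the index of the tail. -/
theorem bijOn_lexIndex (h0 : l 0 = 1) (hpos : ∀ k, 0 < l k) (k : ℕ) :
    Set.BijOn (lexIndex l) {u ∈ lexLanguage l | u.length = k} (Set.Iio (l k)) := by
  refine ⟨?_, ?_, ?_⟩
  · rintro u ⟨hu, rfl⟩
    exact lexIndex_lt hu
  · induction k with
    | zero =>
      rintro u ⟨-, hu⟩ v ⟨-, hv⟩ -
      rw [List.length_eq_zero_iff.1 hu, List.length_eq_zero_iff.1 hv]
    | succ k ih =>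
      rintro (_ | ⟨z, u⟩) ⟨hu, hul⟩ (_ | ⟨y, v⟩) ⟨hv, hvl⟩ huv
      · rfl
      · simp at hul
      · simp at hvl
      · simp only [List.length_cons, add_left_inj] at hul hvl
        obtain ⟨-, hu'⟩ := cons_mem_lexLanguage.1 hu
        obtain ⟨-, hv'⟩ := cons_mem_lexLanguage.1 hv
        have h1 := lexIndex_lt hu'
        have h2 := lexIndex_lt hv'
        simp only [lexIndex, hul, hvl] at huv h1 h2
        have hz : z = y := by
          have := congrArg (· / l k) huv
          simpa [Nat.mul_add_div, mul_comm _ (l k), hpos k, Nat.div_eq_of_lt h1,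
            Nat.div_eq_of_lt h2] using this
        subst hz
        have huv' : lexIndex l u = lexIndex l v := by omega
        rw [show u = v from ih ⟨hu', hul⟩ ⟨hv', hvl⟩ huv']
  · induction k with
    | zero =>
      intro i hi
      rw [h0, Set.mem_Iio, Nat.lt_one_iff] at hi
      exact ⟨[], ⟨nil_mem_lexLanguage hpos, rfl⟩, hi.symm⟩
    | succ k ih =>
      intro i hi
      obtain ⟨v, ⟨hv, hvl⟩, hvi⟩ := ih (Nat.mod_lt i (hpos k))
      have : i / l k * l v.length + lexIndex l v = i := by
        rw [hvl, hvi, Nat.div_add_mod']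
      exact ⟨i / l k :: v, ⟨cons_mem_lexLanguage.2 ⟨by rw [this, hvl]; exact hi, hv⟩, by simp [hvl]⟩,
        this⟩

theorem lt_of_mem_lexLanguage (h0 : l 0 = 1) (hpos : ∀ k, 0 < l k)
    (hlc : ∀ k, l k * l (k + 2) ≤ l (k + 1) ^ 2) {u : List ℕ} (hu : u ∈ lexLanguage l)
    {z : ℕ} (hz : z ∈ u) : z < l 1 := by
  obtain ⟨x, y, rfl⟩ := List.append_of_mem hz
  have h1 := lexLanguage_suffix_closed _ _ hu
  have h2 := lexIndex_lt (lexLanguage_prefix_closed hpos hlc [z] y h1)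
  simpa [lexIndex, h0] using h2

end LexLanguage

/-- If the successive differences of the coefficients of `f` form a positive log-concave sequence
starting from `1`, then `f` is a regular upho function. -/
theorem isRegularUphoFunction_of_logConcave (f : PowerSeries ℤ) (l : ℕ → ℕ) (h0 : l 0 = 1)
    (hpos : ∀ k, 0 < l k) (hlc : ∀ k, l k * l (k + 2) ≤ l (k + 1) ^ 2)
    (hf0 : PowerSeries.coeff 0 f = 1)
    (hf : ∀ k, PowerSeries.coeff (k + 1) f = PowerSeries.coeff k f + (l (k + 1) : ℤ)) :
    Upho.IsRegularUphoFunction f := by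
  refine isRegularUphoFunction_of_language (lexLanguage l) (nil_mem_lexLanguage hpos)
    -- Every letter of a word in the language is less than `l 1`, so `l 1` can serve as the padding
    -- letter.
    (lexLanguage_prefix_closed hpos hlc) lexLanguage_suffix_closed (l 1)
    (fun u hu h => (lt_of_mem_lexLanguage h0 hpos hlc hu h).false) ?_ f hf0 ?_
  · intro k
    exact (Set.BijOn.finite_iff_finite (bijOn_lexIndex h0 hpos k)).2 (Set.finite_Iio _)
  · intro k
    rw [hf, (bijOn_lexIndex h0 hpos (k + 1)).ncard_eq, Set.ncard_eq_toFinset_card']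
    simp

/-! ### Log-concavity of power series -/

/-- A real power series whose coefficients are positive and log-concave. -/
def PowerSeries.IsLogConcave (B : PowerSeries ℝ) : Prop :=
  (∀ k, 0 < coeff k B) ∧ ∀ k, coeff k B * coeff (k + 2) B ≤ coeff (k + 1) B ^ 2

namespace PowerSeries

theorem coeff_zero_mul_one_sub (C : PowerSeries ℝ) (c : ℝ) :
    coeff 0 (C * (1 - PowerSeries.C c * X)) = coeff 0 C := by
  simp [mul_sub]

theorem coeff_succ_mul_one_sub (C : PowerSeries ℝ) (c : ℝ) (k : ℕ) :
    coeff (k + 1) (C * (1 - PowerSeries.C c * X)) = coeff (k + 1) C - c * coeff k C := by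
  rw [mul_sub, mul_one, map_sub, mul_left_comm, coeff_C_mul, coeff_succ_mul_X]

/-- With `B = C (1 - c x)`, the ratio `C_{k+1} / C_k` equals `c + B_{k+1} / C_k`. So it suffices
that `B_{k+1} / C_k` is nonincreasing, which is `key` and follows by induction from the
log-concavity of `B`. -/
theorem IsLogConcave.of_mul_one_sub {C : PowerSeries ℝ} {c : ℝ} (hc : 0 < c)
    (h : (C * (1 - PowerSeries.C c * X)).IsLogConcave) : C.IsLogConcave := by
  set B := C * (1 - PowerSeries.C c * X) with hB
  obtain ⟨hpos, hlc⟩ := h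
  have h0 : coeff 0 C = coeff 0 B := (coeff_zero_mul_one_sub C c).symm
  have hs : ∀ k, coeff (k + 1) C = c * coeff k C + coeff (k + 1) B := by
    intro k
    rw [hB, coeff_succ_mul_one_sub]
    ring
  have hCpos : ∀ k, 0 < coeff k C := by
    intro k
    induction k with
    | zero => rw [h0]; exact hpos 0
    | succ k ih => rw [hs]; have := hpos (k + 1); positivity
  have key : ∀ k, coeff k C * coeff (k + 2) B ≤ coeff (k + 1) C * coeff (k + 1) B := by
    intro k
    induction k with
    | zero =>
      rw [hs, h0]
      have := hlc 0
      have := mul_pos (mul_pos hc (hpos 0)) (hpos 1)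
      simp only [zero_add] at *
      nlinarith
    | succ k ih =>
      have h1 : coeff k C * coeff (k + 3) B ≤ coeff (k + 1) C * coeff (k + 2) B := by
        refine le_of_mul_le_mul_right ?_ (hpos (k + 1))
        have e1 := mul_le_mul_of_nonneg_left (hlc (k + 1)) (hCpos k).le
        have e2 := mul_le_mul_of_nonneg_right ih (hpos (k + 2)).le
        simp only [add_assoc, Nat.reduceAdd] at e1 e2 ⊢
        nlinarith
      have h2 := hlc (k + 1)
      rw [hs (k + 1), hs k]
      rw [hs k] at h1
      simp only [add_assoc, Nat.reduceAdd] at h1 h2 ⊢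
      have h3 := mul_le_mul_of_nonneg_left h1 hc.le
      nlinarith
  refine ⟨hCpos, fun k => ?_⟩
  have := key k
  rw [hs (k + 1), sq]
  nth_rewrite 3 [hs k]
  simp only [add_assoc, Nat.reduceAdd]
  nlinarith

theorem IsLogConcave.of_mul_prod {ι : Type*} (s : Finset ι) (c : ι → ℝ) (hc : ∀ i, 0 < c i)
    (C : PowerSeries ℝ)
    (h : (C * ∏ i ∈ s, (1 - PowerSeries.C (c i) * X)).IsLogConcave) : C.IsLogConcave := by
  classical
  induction s using Finset.induction_on generalizing C with
  | empty => simpa using h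
  | insert i s hi ih =>
    rw [Finset.prod_insert hi, ← mul_assoc] at h
    exact (ih _ h).of_mul_one_sub (hc i)

theorem coeff_succ_of_mul_eq_one_sub_X {U : PowerSeries ℝ} {a : ℝ}
    (h : U * (1 - PowerSeries.C a * X) = 1 - X) :
    coeff 0 U = 1 ∧ ∀ k, coeff (k + 1) U = (a - 1) * a ^ k := by
  have h0 : coeff 0 U = 1 := by
    rw [← coeff_zero_mul_one_sub U a, h]
    simp
  refine ⟨h0, fun k => ?_⟩
  induction k with
  | zero =>
    have := coeff_succ_mul_one_sub U a 0
    rw [h, h0] at this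
    simp [coeff_one] at this
    simp
    linarith
  | succ k ih =>
    have := coeff_succ_mul_one_sub U a (k + 1)
    rw [h, ih] at this
    simp [coeff_one, coeff_X] at this
    rw [pow_succ]
    linarith

/-- Removing either factor gives `G_{k+1} - a G_k = (b - 1) b ^ k` and `G_{k+1} - b G_k = (a - 1) a
^ k`. Hence `G_{k+1} ^ 2 - G_k G_{k+2}` is the product of these two positive quantities. -/
theorem isLogConcave_of_mul_mul_eq {G : PowerSeries ℝ} {a b : ℝ} (ha : 1 < a) (hb : 1 < b)
    (h : G * (1 - PowerSeries.C a * X) * (1 - PowerSeries.C b * X) = 1 - X) :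
    G.IsLogConcave := by
  obtain ⟨-, hv⟩ := coeff_succ_of_mul_eq_one_sub_X h
  rw [mul_right_comm] at h
  obtain ⟨hu0, hu⟩ := coeff_succ_of_mul_eq_one_sub_X h
  rw [coeff_zero_mul_one_sub] at hu0
  simp only [coeff_succ_mul_one_sub] at hu hv
  have hup : ∀ k, 0 < (a - 1) * a ^ k := fun k => mul_pos (by linarith) (by positivity)
  have hvp : ∀ k, 0 < (b - 1) * b ^ k := fun k => mul_pos (by linarith) (by positivity)
  have hpos : ∀ k, 0 < coeff k G := by
    intro k
    induction k with
    | zero => rw [hu0]; exact one_pos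
    | succ k ih =>
      have h1 := hu k
      have h2 := hup k
      have h3 : 0 < b * coeff k G := by positivity
      linarith
  refine ⟨hpos, fun k => ?_⟩
  have h1 := hv k
  have h2 := hv (k + 1)
  have h3 := mul_pos (hvp k) (hup k)
  rw [← hu k] at h3
  rw [pow_succ] at h2
  have e1 : coeff (k + 2) G = a * coeff (k + 1) G + b * ((b - 1) * b ^ k) := by
    simp only [add_assoc, Nat.reduceAdd] at h2
    linarith
  have e2 : a * coeff k G = coeff (k + 1) G - (b - 1) * b ^ k := by linarith
  calc coeff k G * coeff (k + 2) G
      = a * coeff k G * coeff (k + 1) G + b * coeff k G * ((b - 1) * b ^ k) := by rw [e1]; ring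
    _ = coeff (k + 1) G ^ 2
        - (b - 1) * b ^ k * (coeff (k + 1) G - b * coeff k G) := by rw [e2]; ring
    _ ≤ coeff (k + 1) G ^ 2 := by linarith

end PowerSeries

/-! ### The proposition -/

theorem proposition6p2
    (f : PowerSeries ℤ)
    (hf0 : PowerSeries.constantCoeff f = 1)
    (hfnonneg : ∀ k : ℕ, 0 ≤ PowerSeries.coeff k f)
    (h : Polynomial ℤ)
    (hirr : Irreducible h)
    (hfh : f * (h : PowerSeries ℤ) = 1)
    (n : ℕ) (hn : 2 ≤ n) (hdeg : h.natDegree = n)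
    (lam : Fin n → ℝ)
    (hpos : ∀ i, 0 < lam i)
    (hmono : StrictMono lam)
    (hfactor : h.map (Int.castRingHom ℝ) =
      ∏ i : Fin n, (1 - Polynomial.C (lam i) * Polynomial.X))
    (hlam : 1 < lam ⟨n - 2, by omega⟩) :
    Upho.IsUphoFunction f ∧ Upho.IsRegularUphoFunction f := by
  suffices hreg : Upho.IsRegularUphoFunction f from ⟨hreg.isUphoFunction, hreg⟩
  obtain ⟨m, rfl⟩ := Nat.exists_eq_add_of_le' hn
  set F : PowerSeries ℝ := PowerSeries.map (Int.castRingHom ℝ) f with hF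
  have hprod : F * ∏ i : Fin (m + 2), (1 - PowerSeries.C (lam i) * PowerSeries.X) = 1 := by
    have h1 := congrArg (PowerSeries.map (Int.castRingHom ℝ)) hfh
    rw [map_mul, map_one, ← Polynomial.polynomial_map_coe, hfactor] at h1
    refine Eq.trans ?_ h1
    congr 1
    rw [← Polynomial.coeToPowerSeries.ringHom_apply, map_prod]
    simp
  have hb : 1 < lam (Fin.last m).castSucc := hlam
  have ha : 1 < lam (Fin.last (m + 1)) := hb.trans (hmono (Fin.castSucc_lt_last _))
  have hlc : (F * (1 - PowerSeries.X)).IsLogConcave := by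
    -- The `m` smaller `λ`'s need only be positive; the two largest, both above `1`, absorb the
    -- factor `1 - x`.
    refine PowerSeries.IsLogConcave.of_mul_prod Finset.univ
      (fun i : Fin m => lam i.castSucc.castSucc) (fun i => hpos _) _ ?_
    refine PowerSeries.isLogConcave_of_mul_mul_eq hb ha ?_
    rw [Fin.prod_univ_castSucc, Fin.prod_univ_castSucc] at hprod
    linear_combination (1 - PowerSeries.X) * hprod
  set D : PowerSeries ℤ := f * (1 - PowerSeries.X) with hD
  have hDF : ∀ k, PowerSeries.coeff k (F * (1 - PowerSeries.X)) = ((PowerSeries.coeff k D : ℤ) : ℝ) := by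
    intro k
    have : F * (1 - PowerSeries.X) = PowerSeries.map (Int.castRingHom ℝ) D := by
      rw [hD, map_mul, map_sub, map_one, PowerSeries.map_X]
    rw [this, PowerSeries.coeff_map]
    rfl
  simp only [PowerSeries.IsLogConcave, hDF] at hlc
  have hc0 : PowerSeries.coeff 0 f = 1 := by
    rw [PowerSeries.coeff_zero_eq_constantCoeff_apply, hf0]
  obtain ⟨l, hl⟩ : ∃ l : ℕ → ℕ, ∀ k, (l k : ℤ) = PowerSeries.coeff k D :=
    ⟨fun k => (PowerSeries.coeff k D).toNat,
      fun k => Int.toNat_of_nonneg (by exact_mod_cast (hlc.1 k).le)⟩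
  simp only [← hl] at hlc
  refine isRegularUphoFunction_of_logConcave f l ?_ (fun k => by exact_mod_cast hlc.1 k)
    (fun k => by exact_mod_cast hlc.2 k) hc0 fun k => ?_
  · have : (l 0 : ℤ) = 1 := by rw [hl, hD, mul_sub, mul_one]; simp [hf0]
    exact_mod_cast this
  · rw [hl, hD, mul_sub, mul_one, map_sub, PowerSeries.coeff_succ_mul_X]
    ring
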